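/- Fix integers $1\le k\le d-1$. For $r>0$ and an integer $j\ge 0$, an $(r,j)$-plate is the open $r$-neighborhood in $\mathbb{R}^d$ of a $j$-dimensional affine plane. For $A\subset\mathbb{R}^d\times\mathbb{R}^d$ write $A|_x=\{y:(x,y)\in A\}$. For every $\kappa>0$ there exists $\eta=\eta(\kappa,k,d)>0$ such that for all $C_\mu,C_\nu$ there exists $K_0=K_0(\kappa,k,d,C_\mu,C_\nu)>0$ with the following property. Let $0<r_0\le 1$ and $K\ge K_0$. Let $\mu,\nu$ be finite positive Borel measures on $\mathbb{R}^d$ supported on sets $X,Y\subset \overline{B}(0,1)$ (that is, $\mu(\mathbb{R}^d\setminus X)=\nu(\mathbb{R}^d\setminus Y)=0$), such that for every $r>0$ and every $(r,k-1)$-plate $H$, $$\mu(H)\le C_\mu r^\kappa,\qquad \nu(H)\le C_\nu r^\kappa .$$ Let $A\subset X\times Y$ be the set of pairs $(x,y)\in X\times Y$ for which there is an $(r_0,k)$-plate $H$ with $x,y\in H$ and $\nu(H)\ge K^{-1}$. Then there exists a Borel set $B\subset\mathbb{R}^d\times\mathbb{R}^d$ with $$(\mu\times\nu)(B)\le K_0K^{-1}$$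 such that $(\mu,\nu)$ has $(\eta,Kr_0^{-\eta})$-thin $k$-plates on $(A\cup B)^c$ (complement in $\mathbb{R}^d\times\mathbb{R}^d$), i.e. for every $x\in\mathbb{R}^d$, every $r>0$ and every $(r,k)$-plate $H$ containing $x$, $$\nu\bigl(H\setminus(A|_x\cup B|_x)\bigr)\le K\left(\frac{r}{r_0}\right)^{\eta}.$$ -/

import Mathlib

open MeasureTheory

/-- An `(r, k)`-plate in `ℝ^d`: the (open) `r`-neighbourhood of a `k`-dimensional affine plane. -/
def IsPlate {d : ℕ} (r : ℝ) (k : ℕ) (H : Set (EuclideanSpace ℝ (Fin d))) : Prop :=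
  ∃ V : AffineSubspace ℝ (EuclideanSpace ℝ (Fin d)),
    (V : Set (EuclideanSpace ℝ (Fin d))).Nonempty ∧
    Module.finrank ℝ V.direction = k ∧
    H = Metric.thickening r (V : Set (EuclideanSpace ℝ (Fin d)))

/-- `μ` has `κ`-power decay, with constant `C`, on plates of dimension `k`:
`μ(H) ≤ C r^κ` for every `(r, k)`-plate `H`. -/
def HasPlateDecay {d : ℕ} (μ : Measure (EuclideanSpace ℝ (Fin d))) (k : ℕ) (κ C : ℝ) : Prop :=
  ∀ r : ℝ, 0 < r → ∀ H : Set (EuclideanSpace ℝ (Fin d)), IsPlate r k H →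
    μ H ≤ ENNReal.ofReal (C * r ^ κ)

/-- A plate `H` is `c`-concentrated on `ν` if `ν(H) ≥ c`. -/
def IsConcentrated {d : ℕ} (ν : Measure (EuclideanSpace ℝ (Fin d))) (c : ℝ)
    (H : Set (EuclideanSpace ℝ (Fin d))) : Prop :=
  ENNReal.ofReal c ≤ ν H

/-- The pairs `(x, y) ∈ X × Y` that lie in some `(r, k)`-plate that is `c`-concentrated on `ν`. -/
def concentratedPairs {d : ℕ} (ν : Measure (EuclideanSpace ℝ (Fin d)))
    (X Y : Set (EuclideanSpace ℝ (Fin d))) (c r : ℝ) (k : ℕ) :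
    Set (EuclideanSpace ℝ (Fin d) × EuclideanSpace ℝ (Fin d)) :=
  {p | p.1 ∈ X ∧ p.2 ∈ Y ∧ ∃ H : Set (EuclideanSpace ℝ (Fin d)),
    IsPlate r k H ∧ IsConcentrated ν c H ∧ p.1 ∈ H ∧ p.2 ∈ H}

/-- `(t, K)`-thin `k`-plates on `G` down from scale `r₁`: `ν(H ∩ G|ₓ) ≤ K r^t` for all
`r ∈ (0, r₁)` and all `(r, k)`-plates `H` containing `x`. Here `x` ranges over all of `ℝ^d`
(not only over the support of the first measure `μ` of the pair, which is the only role of `μ`). -/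
def HasThinPlates {d : ℕ} (ν : Measure (EuclideanSpace ℝ (Fin d))) (k : ℕ) (t K : ℝ)
    (G : Set (EuclideanSpace ℝ (Fin d) × EuclideanSpace ℝ (Fin d))) (r₁ : ℝ) : Prop :=
  ∀ x : EuclideanSpace ℝ (Fin d), ∀ r : ℝ, 0 < r → r < r₁ →
    ∀ H : Set (EuclideanSpace ℝ (Fin d)), IsPlate r k H → x ∈ H →
      ν (H ∩ {y | (x, y) ∈ G}) ≤ ENNReal.ofReal (K * r ^ t)

/-!
If two `k`-planes are not close to each other at scale `r`, the intersection of their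
`ρ`-neighbourhoods in the unit ball lies in the `O(ρ / r)`-neighbourhood of a `(k - 1)`-plane, so
power decay makes its mass small. Hence the planes whose `ρ`-neighbourhood has `ν`-mass at least
`t ^ 2` are covered by few of them, up to small perturbations: many plates of large mass with small
pairwise intersections would exceed the total mass of `ν`.

Call a member of this net light if its neighbourhood at the next larger scale has mass less than
`t`. A point `x` lying only in net members that are close to each other sees, through the light
ones, `ν`-mass less than `t`; the other points `x` lie in the pairwise intersections of transverse
members and have small `μ`-mass. So, up to a set of pairs of measure `O(t)`, a pair in a plate of
mass `t ^ 2` lies in a plate of mass `t` at the larger scale. Iterating with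
`t = K⁻¹, K⁻², K⁻⁴, …` gives a geometric series of exceptional sets, and scales which shrink like a
fixed power of the thresholds, whence the exponent of the thin plates.
-/

section Geometry

variable {E : Type*} [NormedAddCommGroup E]

section NormedSpace

variable [NormedSpace ℝ E]

/-- The part in the closed unit ball of the open `r`-neighbourhood of the affine subspace `V`.
Measures carried by the unit ball only see this part of a plate. -/
def ballPlate (r : ℝ) (V : AffineSubspace ℝ E) : Set E :=
  Metric.thickening r (V : Set E) ∩ Metric.closedBall 0 1

/-- One-sided closeness of affine subspaces at scale `r`: the part of `V` in the closed ball of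
radius `2` lies in the `r`-neighbourhood of `W`. Radius `2` accounts for the points of `V` within
distance `1` of the unit ball. -/
def NearOnBall (r : ℝ) (V W : AffineSubspace ℝ E) : Prop :=
  (V : Set E) ∩ Metric.closedBall 0 2 ⊆ Metric.thickening r (W : Set E)

theorem NearOnBall.ballPlate_subset {r ρ : ℝ} {V W : AffineSubspace ℝ E}
    (h : NearOnBall r V W) (hρ : ρ ≤ 1) : ballPlate ρ V ⊆ ballPlate (ρ + r) W := by
  rintro x ⟨hxV, hx⟩
  obtain ⟨v, hv, hxv⟩ := Metric.mem_thickening_iff.1 hxV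
  have hv2 : v ∈ Metric.closedBall (0 : E) 2 := by
    rw [Metric.mem_closedBall] at hx ⊢
    linarith [dist_triangle_left v 0 x]
  obtain ⟨w, hw, hvw⟩ := Metric.mem_thickening_iff.1 (h ⟨hv, hv2⟩)
  exact ⟨Metric.mem_thickening_iff.2 ⟨w, hw, by linarith [dist_triangle x v w]⟩, hx⟩

theorem ballPlate_mono {r s : ℝ} (h : r ≤ s) (V : AffineSubspace ℝ E) :
    ballPlate r V ⊆ ballPlate s V :=
  Set.inter_subset_inter_left _ (Metric.thickening_mono h _)

theorem measurableSet_ballPlate [MeasurableSpace E] [OpensMeasurableSpace E] (r : ℝ)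
    (V : AffineSubspace ℝ E) : MeasurableSet (ballPlate r V) :=
  Metric.isOpen_thickening.measurableSet.inter Metric.isClosed_closedBall.measurableSet

end NormedSpace

variable [InnerProductSpace ℝ E]

theorem exists_inner_sub_eq_of_notMem_thickening {W : AffineSubspace ℝ E}
    (hW : (W : Set E).Nonempty) [W.direction.HasOrthogonalProjection] {v : E} {r : ℝ}
    (hv : v ∉ Metric.thickening r (W : Set E)) :
    ∃ u : E, r ≤ ‖u‖ ∧ ∀ w ∈ W, inner ℝ u (w - v) = -‖u‖ ^ 2 := by
  have : Nonempty W := hW.to_subtype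
  let p : E := ↑(EuclideanGeometry.orthogonalProjection W v)
  have hp : p ∈ W := EuclideanGeometry.orthogonalProjection_mem v
  refine ⟨v - p, ?_, fun w hw => ?_⟩
  · rw [← dist_eq_norm]
    exact not_lt.1 fun h => hv (Metric.mem_thickening_iff.2 ⟨p, hp, h⟩)
  · have horth : inner ℝ (v - p) (w - p) = 0 :=
      Submodule.inner_left_of_mem_orthogonal (AffineSubspace.vsub_mem_direction hw hp)
        (EuclideanGeometry.vsub_orthogonalProjection_mem_direction_orthogonal W v)
    rw [← sub_sub_sub_cancel_right w v p, inner_sub_right, horth, real_inner_self_eq_norm_sq,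
      zero_sub]

theorem exists_hyperplane_section {V : AffineSubspace ℝ E} [FiniteDimensional ℝ V.direction]
    {v g : E} (hv : v ∈ V) (hg : g ∈ V.direction) (hg0 : g ≠ 0) (a : ℝ) :
    ∃ U : AffineSubspace ℝ E, (U : Set E).Nonempty ∧
      Module.finrank ℝ U.direction + 1 = Module.finrank ℝ V.direction ∧
      ∀ x ∈ V, ∃ y ∈ U, dist x y = |inner ℝ g (x - v) - a| / ‖g‖ := by
  have hg' : ‖g‖ ≠ 0 := norm_ne_zero_iff.2 hg0
  set z := v + (a / ‖g‖ ^ 2) • g with hz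
  refine ⟨AffineSubspace.mk' z ((ℝ ∙ g)ᗮ ⊓ V.direction),
    ⟨z, AffineSubspace.self_mem_mk' _ _⟩, ?_, fun x hx => ?_⟩
  · have hspan : ℝ ∙ g ≤ V.direction := (Submodule.span_singleton_le_iff_mem _ _).2 hg
    rw [AffineSubspace.direction_mk', ← Submodule.finrank_add_inf_finrank_orthogonal hspan,
      finrank_span_singleton hg0, add_comm]
  · set b := (inner ℝ g (x - v) - a) / ‖g‖ ^ 2 with hb
    have hyz : x - b • g - z = (x - v) - (inner ℝ g (x - v) / ‖g‖ ^ 2) • g := by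
      rw [hb, hz, sub_div, sub_smul]
      abel
    refine ⟨x - b • g, AffineSubspace.mem_mk'.2 ?_, ?_⟩
    · rw [vsub_eq_sub, hyz]
      refine ⟨?_, V.direction.sub_mem (AffineSubspace.vsub_mem_direction hx hv)
        (V.direction.smul_mem _ hg)⟩
      rw [SetLike.mem_coe, Submodule.mem_orthogonal_singleton_iff_inner_right, inner_sub_right,
        inner_smul_right, real_inner_self_eq_norm_sq, div_mul_cancel₀ _ (pow_ne_zero 2 hg'),
        sub_self]
    · rw [dist_eq_norm, sub_sub_cancel, norm_smul, hb, Real.norm_eq_abs, abs_div, abs_pow, abs_norm]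
      field_simp

theorem exists_hyperplane_section_near {V : AffineSubspace ℝ E} [FiniteDimensional ℝ V.direction]
    {v x₀ u : E} {ε R : ℝ} (hv : v ∈ V) (hu : 0 < ‖u‖) (hε : 2 * ε ≤ ‖u‖ ^ 2)
    (hx₀ : x₀ ∈ V) (hR : ‖x₀ - v‖ ≤ R) (hx₀u : |inner ℝ u (x₀ - v) + ‖u‖ ^ 2| ≤ ε) :
    ∃ U : AffineSubspace ℝ E, (U : Set E).Nonempty ∧
      Module.finrank ℝ U.direction + 1 = Module.finrank ℝ V.direction ∧
      ∀ x ∈ V, |inner ℝ u (x - v) + ‖u‖ ^ 2| ≤ ε →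
        ∃ y ∈ U, dist x y ≤ 2 * R * ε / ‖u‖ ^ 2 := by
  -- The gradient of `x ↦ ⟪u, x - v⟫` along `V` is the projection `g` of `u`; it cannot be small,
  -- because this function is far from its value `0` at `v` when evaluated at `x₀`.
  set g := V.direction.starProjection u
  have hgV : g ∈ V.direction := Submodule.starProjection_apply_mem _ _
  have hug : ∀ x ∈ V, inner ℝ u (x - v) = inner ℝ g (x - v) := fun x hx => by
    have h := Submodule.starProjection_inner_eq_zero u (x - v)
      (AffineSubspace.vsub_mem_direction hx hv)
    rwa [inner_sub_left, sub_eq_zero] at h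
  have hgR : ‖u‖ ^ 2 ≤ 2 * (‖g‖ * R) := by
    have hle : |inner ℝ g (x₀ - v)| ≤ ‖g‖ * R :=
      (abs_real_inner_le_norm _ _).trans (by gcongr)
    rw [← hug x₀ hx₀] at hle
    linarith [(abs_le.1 hle).1, (abs_le.1 hx₀u).2]
  have hg : 0 < ‖g‖ := (norm_nonneg g).lt_of_ne fun h => by
    rw [← h, zero_mul, mul_zero] at hgR
    exact hgR.not_gt (by positivity)
  obtain ⟨U, hUne, hUdim, hU⟩ :=
    exists_hyperplane_section hv hgV (norm_pos_iff.1 hg) (-‖u‖ ^ 2)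
  refine ⟨U, hUne, hUdim, fun x hx hxu => ?_⟩
  obtain ⟨y, hy, hxy⟩ := hU x hx
  refine ⟨y, hy, ?_⟩
  rw [hxy, ← hug x hx, sub_neg_eq_add, div_le_div_iff₀ hg (by positivity)]
  calc |inner ℝ u (x - v) + ‖u‖ ^ 2| * ‖u‖ ^ 2 ≤ ε * (2 * (‖g‖ * R)) := by
        gcongr
        exact (abs_nonneg _).trans hxu
    _ = 2 * R * ε * ‖g‖ := by ring

theorem exists_mem_abs_inner_sub_add_sq_le {V W : AffineSubspace ℝ E} {v u x : E} {ρ : ℝ}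
    (hv2 : v ∈ Metric.closedBall 0 2) (hu : ∀ w ∈ W, inner ℝ u (w - v) = -‖u‖ ^ 2)
    (hx : x ∈ ballPlate ρ V ∩ ballPlate ρ W) :
    ∃ x' ∈ V, dist x x' < ρ ∧ ‖x' - v‖ ≤ ρ + 3 ∧
      |inner ℝ u (x' - v) + ‖u‖ ^ 2| ≤ 2 * ρ * ‖u‖ := by
  obtain ⟨⟨hxV, hx⟩, hxW, -⟩ := hx
  obtain ⟨x', hx', hxx'⟩ := Metric.mem_thickening_iff.1 hxV
  obtain ⟨w, hw, hxw⟩ := Metric.mem_thickening_iff.1 hxW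
  refine ⟨x', hx', hxx', ?_, ?_⟩
  · rw [Metric.mem_closedBall] at hx hv2
    rw [← dist_eq_norm]
    linarith [dist_triangle_left x' v x, dist_triangle_right x v 0]
  · have hinner : inner ℝ u (x' - v) + ‖u‖ ^ 2 = inner ℝ u (x' - w) := by
      rw [← sub_sub_sub_cancel_right x' w v, inner_sub_right u (x' - v), hu w hw,
        sub_neg_eq_add]
    have hdist : ‖x' - w‖ ≤ 2 * ρ := by
      rw [← dist_eq_norm]
      linarith [dist_triangle_left x' w x]
    rw [hinner, mul_comm]
    exact (abs_real_inner_le_norm _ _).trans (by gcongr)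

theorem exists_ballPlate_inter_subset_thickening {V W : AffineSubspace ℝ E}
    [FiniteDimensional ℝ V.direction] [W.direction.HasOrthogonalProjection] {r ρ : ℝ}
    (hr : r ≤ 1) (hρr : 4 * ρ ≤ r) (hVW : ¬ NearOnBall r V W)
    (hne : (ballPlate ρ V ∩ ballPlate ρ W).Nonempty) :
    ∃ U : AffineSubspace ℝ E, (U : Set E).Nonempty ∧
      Module.finrank ℝ U.direction + 1 = Module.finrank ℝ V.direction ∧
      ballPlate ρ V ∩ ballPlate ρ W ⊆ Metric.thickening (18 * ρ / r) (U : Set E) := by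
  obtain ⟨v, ⟨hv, hv2⟩, hvW⟩ := Set.not_subset.1 hVW
  obtain ⟨x₀, hx₀⟩ := hne
  obtain ⟨p, hp, hxp⟩ := Metric.mem_thickening_iff.1 hx₀.2.1
  have hρ : 0 < ρ := dist_nonneg.trans_lt hxp
  obtain ⟨u, hru, hu⟩ := exists_inner_sub_eq_of_notMem_thickening ⟨p, hp⟩ hvW
  obtain ⟨x₁, hx₁, -, hx₁v, hx₁u⟩ := exists_mem_abs_inner_sub_add_sq_le hv2 hu hx₀
  have hr0 : 0 < r := by linarith
  obtain ⟨U, hUne, hUdim, hU⟩ := exists_hyperplane_section_near hv (hr0.trans_le hru)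
    (by nlinarith) hx₁ (R := 4) (by linarith) hx₁u
  refine ⟨U, hUne, hUdim, fun x hx => ?_⟩
  obtain ⟨x', hx', hxx', -, hx'u⟩ := exists_mem_abs_inner_sub_add_sq_le hv2 hu hx
  obtain ⟨y, hy, hxy⟩ := hU x' hx' hx'u
  refine Metric.mem_thickening_iff.2 ⟨y, hy, ?_⟩
  calc dist x y ≤ dist x x' + dist x' y := dist_triangle _ _ _
    _ < ρ + 2 * 4 * (2 * ρ * ‖u‖) / ‖u‖ ^ 2 := add_lt_add_of_lt_of_le hxx' hxy
    _ = ρ + 16 * ρ / ‖u‖ := by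
        have : ‖u‖ ≠ 0 := by linarith
        field_simp
        norm_num
    _ ≤ 2 * ρ / r + 16 * ρ / r := by
        gcongr
        rw [le_div_iff₀ hr0]
        nlinarith
    _ = 18 * ρ / r := by ring

end Geometry

section Measure

variable {Ω α : Type*} [MeasurableSpace Ω] {ν : Measure Ω} [IsFiniteMeasure ν] {E : α → Set Ω}

theorem sum_measureReal_le_measureReal_biUnion_add {δ : ℝ} (hδ : 0 ≤ δ) (s : Finset α)
    (hE : ∀ a ∈ s, MeasurableSet (E a))
    (hinter : (s : Set α).Pairwise fun a b => ν.real (E a ∩ E b) ≤ δ) :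
    ∑ a ∈ s, ν.real (E a) ≤ ν.real (⋃ a ∈ s, E a) + (s.card : ℝ) ^ 2 * δ := by
  classical
  induction s using Finset.induction_on with
  | empty => simp
  | insert a s ha ih =>
    rw [Finset.coe_insert, Set.pairwise_insert_of_notMem (by simpa using ha)] at hinter
    rw [Finset.forall_mem_insert] at hE
    have hadd := measureReal_union_add_inter (μ := ν) (s := E a)
      (s.measurableSet_biUnion hE.2) (measure_ne_top _ _) (measure_ne_top _ _)
    have hnew : ν.real (E a ∩ ⋃ b ∈ s, E b) ≤ s.card * δ := by
      rw [Set.inter_iUnion₂, ← nsmul_eq_mul]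
      exact (measureReal_biUnion_finset_le s _).trans
        (s.sum_le_card_nsmul _ _ fun b hb => (hinter.2 b hb).1)
    rw [Finset.sum_insert ha, Finset.card_insert_of_notMem ha, Finset.set_biUnion_insert,
      Nat.cast_succ]
    nlinarith [ih hE.2 hinter.1, Nat.cast_nonneg (α := ℝ) s.card]

theorem card_lt_of_pairwise_measureReal_inter_le {τ δ : ℝ} (hδ : 0 ≤ δ) {L : ℕ}
    (hL : ν.real Set.univ + (L : ℝ) ^ 2 * δ < L * τ) {s : Finset α}
    (hE : ∀ a ∈ s, MeasurableSet (E a)) (hτ : ∀ a ∈ s, τ ≤ ν.real (E a))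
    (hinter : (s : Set α).Pairwise fun a b => ν.real (E a ∩ E b) ≤ δ) : s.card < L := by
  by_contra! hLs
  obtain ⟨t, hts, rfl⟩ := Finset.exists_subset_card_eq hLs
  have hsum := sum_measureReal_le_measureReal_biUnion_add hδ t (fun a ha => hE a (hts ha))
    (hinter.mono (Finset.coe_subset.2 hts))
  have hcard := t.card_nsmul_le_sum _ _ fun a ha => hτ a (hts ha)
  have huniv : ν.real (⋃ a ∈ t, E a) ≤ ν.real Set.univ := measureReal_mono (Set.subset_univ _)
  rw [nsmul_eq_mul] at hcard
  linarith

theorem exists_finset_forall_lt_measureReal_inter {τ δ : ℝ} (hδ : 0 ≤ δ) {L : ℕ}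
    (hL : ν.real Set.univ + (L : ℝ) ^ 2 * δ < L * τ) {S : Set α}
    (hE : ∀ a ∈ S, MeasurableSet (E a)) (hτ : ∀ a ∈ S, τ ≤ ν.real (E a)) :
    ∃ s : Finset α, ↑s ⊆ S ∧ s.card < L ∧ ∀ a ∈ S, ∃ b ∈ s, δ < ν.real (E a ∩ E b) := by
  classical
  have hδτ : δ < τ := by
    have hLL : (L : ℝ) * δ ≤ (L : ℝ) ^ 2 * δ := by
      gcongr
      exact_mod_cast Nat.le_self_pow two_ne_zero L
    refine lt_of_mul_lt_mul_left ?_ L.cast_nonneg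
    linarith [measureReal_nonneg (μ := ν) (s := Set.univ)]
  let P : Set (Finset α) :=
    {s | ↑s ⊆ S ∧ (s : Set α).Pairwise fun a b => ν.real (E a ∩ E b) ≤ δ}
  have hPL : ∀ s ∈ P, s.card < L := fun s hs =>
    card_lt_of_pairwise_measureReal_inter_le hδ hL (fun a ha => hE a (hs.1 ha))
      (fun a ha => hτ a (hs.1 ha)) hs.2
  obtain ⟨_, ⟨s, hs, rfl⟩, hmax⟩ := BddAbove.exists_isGreatest_of_nonempty
    (S := Finset.card '' P) ⟨L, Set.forall_mem_image.2 fun s hs => (hPL s hs).le⟩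
    ⟨0, ∅, by simp [P], rfl⟩
  refine ⟨s, hs.1, hPL s hs, fun a ha => ?_⟩
  by_contra! hsmall
  have has : a ∉ s := fun h =>
    ((hδτ.trans_le (hτ a ha)).trans_eq (by rw [Set.inter_self])).not_ge (hsmall a h)
  have hinsert : insert a s ∈ P := by
    refine ⟨?_, ?_⟩ <;> rw [Finset.coe_insert]
    · exact Set.insert_subset ha hs.1
    · exact hs.2.insert fun b hb _ => ⟨hsmall b hb, Set.inter_comm (E a) (E b) ▸ hsmall b hb⟩
  have hcard := hmax ⟨_, hinsert, rfl⟩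
  rw [Finset.card_insert_of_notMem has] at hcard
  omega

theorem measure_prod_le_of_forall_slice_le {Ω' : Type*} [MeasurableSpace Ω'] {μ : Measure Ω'}
    {ν : Measure Ω} {D : Set (Ω' × Ω)} (hD : MeasurableSet D) {F : Set Ω'} (hF : MeasurableSet F)
    {c : ENNReal} (hslice : ∀ x ∉ F, ν (Prod.mk x ⁻¹' D) ≤ c) :
    (μ.prod ν) D ≤ ν Set.univ * μ F + c * μ Set.univ := by
  calc (μ.prod ν) D ≤ ∫⁻ x, ν (Prod.mk x ⁻¹' D) ∂μ := Measure.prod_apply_le hD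
    _ ≤ ∫⁻ x, F.indicator (fun _ => ν Set.univ) x + c ∂μ := by
        refine lintegral_mono fun x => ?_
        by_cases hx : x ∈ F
        · rw [Set.indicator_of_mem hx]
          exact (measure_mono (Set.subset_univ _)).trans le_self_add
        · exact (hslice x hx).trans le_add_self
    _ = ν Set.univ * μ F + c * μ Set.univ := by
        rw [lintegral_add_right _ measurable_const, lintegral_indicator_const hF, lintegral_const]

end Measure

section Scales

variable {κ K : ℝ}

/-- The mass thresholds of the multiscale argument: `concThreshold K n = K ^ (-2 ^ n)`, each the
square of the preceding one. -/
noncomputable def concThreshold (K : ℝ) (n : ℕ) : ℝ :=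
  K⁻¹ ^ 2 ^ n

/-- The scales of the multiscale argument, relative to the initial one. One step shrinks the scale
by the factor `q ^ 2` with `q = concThreshold K n ^ (6 / κ)`: then `q ^ κ`, the order of magnitude
of the mass of a transverse intersection, is the sixth power of the threshold. -/
noncomputable def relScale (κ K : ℝ) (n : ℕ) : ℝ :=
  (K * concThreshold K n) ^ (12 / κ)

theorem concThreshold_zero : concThreshold K 0 = K⁻¹ := by
  rw [concThreshold, pow_zero, pow_one]

theorem concThreshold_succ (n : ℕ) : concThreshold K (n + 1) = concThreshold K n ^ 2 := by
  rw [concThreshold, concThreshold, pow_succ, pow_mul]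

theorem concThreshold_pos (hK : 0 < K) (n : ℕ) : 0 < concThreshold K n :=
  pow_pos (inv_pos.2 hK) _

theorem concThreshold_le_inv_mul (hK : 2 ≤ K) (n : ℕ) :
    concThreshold K n ≤ K⁻¹ * (1 / 2) ^ n := by
  have hK0 : 0 < K := by linarith
  calc K⁻¹ ^ 2 ^ n ≤ K⁻¹ ^ (n + 1) :=
        pow_le_pow_of_le_one (inv_nonneg.2 hK0.le) (inv_le_one_of_one_le₀ (by linarith))
          n.lt_two_pow_self
    _ = K⁻¹ * K⁻¹ ^ n := pow_succ' _ _
    _ ≤ K⁻¹ * (1 / 2) ^ n := by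
        rw [inv_eq_one_div]
        gcongr

theorem mul_concThreshold_le (hK : 2 ≤ K) (n : ℕ) : K * concThreshold K n ≤ (1 / 2) ^ n := by
  have hK0 : 0 < K := by linarith
  rw [← le_inv_mul_iff₀ hK0]
  exact concThreshold_le_inv_mul hK n

theorem mul_concThreshold_le_one (hK : 2 ≤ K) (n : ℕ) : K * concThreshold K n ≤ 1 :=
  (mul_concThreshold_le hK n).trans (pow_le_one₀ (by norm_num) (by norm_num))

theorem relScale_zero (hK : K ≠ 0) : relScale κ K 0 = 1 := by
  rw [relScale, concThreshold_zero, mul_inv_cancel₀ hK, Real.one_rpow]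

theorem relScale_succ (hK : 0 < K) (n : ℕ) :
    relScale κ K (n + 1) = relScale κ K n * (concThreshold K n ^ (6 / κ)) ^ 2 := by
  have ht := concThreshold_pos hK n
  rw [relScale, relScale, concThreshold_succ, sq, ← mul_assoc,
    Real.mul_rpow (by positivity) ht.le, ← Real.rpow_mul_natCast ht.le, Nat.cast_ofNat]
  ring_nf

theorem relScale_pos (hK : 0 < K) (n : ℕ) : 0 < relScale κ K n :=
  Real.rpow_pos_of_pos (mul_pos hK (concThreshold_pos hK n)) _

theorem relScale_le_one (hκ : 0 < κ) (hK : 2 ≤ K) (n : ℕ) : relScale κ K n ≤ 1 := by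
  have hK0 : 0 < K := by linarith
  exact Real.rpow_le_one (mul_pos hK0 (concThreshold_pos hK0 n)).le
    (mul_concThreshold_le_one hK n) (by positivity)

theorem tendsto_relScale (hκ : 0 < κ) (hK : 2 ≤ K) :
    Filter.Tendsto (relScale κ K) Filter.atTop (nhds 0) := by
  have hK0 : 0 < K := by linarith
  have hlim : Filter.Tendsto (fun n => K * concThreshold K n) Filter.atTop (nhds 0) :=
    squeeze_zero (fun n => (mul_pos hK0 (concThreshold_pos hK0 n)).le) (mul_concThreshold_le hK)
      (tendsto_pow_atTop_nhds_zero_of_lt_one (by norm_num) (by norm_num))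
  have hexp : 0 < 12 / κ := by positivity
  rw [← Real.zero_rpow hexp.ne']
  exact hlim.rpow_const (Or.inr hexp.le)

theorem concThreshold_le_relScale_succ_rpow (hκ : 0 < κ) (hK : 1 ≤ K) (n : ℕ) :
    concThreshold K n ≤ relScale κ K (n + 1) ^ (κ / 24) := by
  have hK0 : 0 < K := by linarith
  have ht := concThreshold_pos hK0 n
  calc concThreshold K n = (concThreshold K n ^ 2) ^ (1 / 2 : ℝ) := by
        rw [← Real.sqrt_eq_rpow, Real.sqrt_sq ht.le]
    _ ≤ (K * concThreshold K n ^ 2) ^ (1 / 2 : ℝ) := by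
        gcongr
        exact le_mul_of_one_le_left (sq_nonneg _) hK
    _ = relScale κ K (n + 1) ^ (κ / 24) := by
        rw [relScale, concThreshold_succ, ← Real.rpow_mul (by positivity)]
        congr 1
        field_simp
        norm_num

-- The last scale above `u` works, since the next one is already below `u`.
theorem exists_le_relScale_concThreshold_le (hκ : 0 < κ) (hK : 2 ≤ K) {u : ℝ} (hu : 0 < u)
    (hu1 : u ≤ 1) : ∃ n, u ≤ relScale κ K n ∧ concThreshold K n ≤ u ^ (κ / 24) := by
  have hK0 : 0 < K := by linarith
  have hex : ∃ n, relScale κ K n < u := ((tendsto_relScale hκ hK).eventually_lt_const hu).exists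
  have hzero : relScale κ K 0 = 1 := relScale_zero hK0.ne'
  obtain ⟨n, hn⟩ : ∃ n, Nat.find hex = n + 1 := Nat.exists_eq_succ_of_ne_zero fun h0 =>
    (hzero ▸ h0 ▸ Nat.find_spec hex).not_ge hu1
  refine ⟨n, not_lt.1 (Nat.find_min hex (hn ▸ n.lt_succ_self)),
    (concThreshold_le_relScale_succ_rpow hκ (by linarith) n).trans ?_⟩
  have hlt : relScale κ K (n + 1) < u := hn ▸ Nat.find_spec hex
  have hpos : 0 < relScale κ K (n + 1) := relScale_pos hK0 _
  gcongr

end Scales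

section LightPairs

variable {E : Type*} [NormedAddCommGroup E] [NormedSpace ℝ E]

/-- The points of the unit ball lying in the `ρ`-neighbourhoods of two members of the family `s`
that are not close to each other at scale `r`. -/
def transverseOverlap (ρ r : ℝ) (s : Finset (AffineSubspace ℝ E)) : Set E :=
  ⋃ p ∈ s ×ˢ s, ⋃ _ : ¬ NearOnBall r p.1 p.2, ballPlate ρ p.1 ∩ ballPlate ρ p.2

variable [MeasurableSpace E]

/-- The pairs of points of the unit ball lying in the `ρ`-neighbourhood of a common member of the
family `s` whose `σ`-neighbourhood is light, that is, has measure less than `c`. -/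
def lightPairs (ν : Measure E) (c : ENNReal) (σ ρ : ℝ) (s : Finset (AffineSubspace ℝ E)) :
    Set (E × E) :=
  ⋃ V ∈ s, ⋃ _ : ν (Metric.thickening σ (V : Set E)) < c, ballPlate ρ V ×ˢ ballPlate ρ V

variable {ν : Measure E} {c : ENNReal} {ρ r σ : ℝ} {s : Finset (AffineSubspace ℝ E)}

theorem mem_lightPairs {x y : E} : (x, y) ∈ lightPairs ν c σ ρ s ↔
    ∃ V ∈ s, ν (Metric.thickening σ (V : Set E)) < c ∧ x ∈ ballPlate ρ V ∧ y ∈ ballPlate ρ V := by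
  simp only [lightPairs, Set.mem_iUnion, Set.mem_prod, exists_prop]

-- Off the transverse overlap, all members of `s` through `x` are close to a single light one.
theorem measure_slice_lightPairs_le (hρ : ρ ≤ 1) (hσ : ρ + r ≤ σ) {x : E}
    (hx : x ∉ transverseOverlap ρ r s) : ν (Prod.mk x ⁻¹' lightPairs ν c σ ρ s) ≤ c := by
  rcases (Prod.mk x ⁻¹' lightPairs ν c σ ρ s).eq_empty_or_nonempty with hempty | ⟨y₀, hy₀⟩
  · simp [hempty]
  obtain ⟨V, hV, hVc, hxV, -⟩ := mem_lightPairs.1 hy₀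
  refine (measure_mono fun y hy => ?_).trans hVc.le
  obtain ⟨W, hW, -, hxW, hyW⟩ := mem_lightPairs.1 hy
  have hWV : NearOnBall r W V := by
    by_contra hWV
    exact hx (Set.mem_biUnion (Finset.mk_mem_product hW hV) (Set.mem_iUnion.2 ⟨hWV, hxW, hxV⟩))
  exact (ballPlate_mono hσ V (hWV.ballPlate_subset hρ hyW)).1

theorem measureReal_transverseOverlap_le {μ : Measure E} {δ : ℝ} (hδ : 0 ≤ δ)
    (hs : ∀ V ∈ s, ∀ W ∈ s, ¬ NearOnBall r V W → μ.real (ballPlate ρ V ∩ ballPlate ρ W) ≤ δ) :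
    μ.real (transverseOverlap ρ r s) ≤ (s.card : ℝ) ^ 2 * δ := by
  have hpair : ∀ p ∈ s ×ˢ s, μ.real
      (⋃ _ : ¬ NearOnBall r p.1 p.2, ballPlate ρ p.1 ∩ ballPlate ρ p.2) ≤ δ := by
    intro p hp
    obtain ⟨hV, hW⟩ := Finset.mem_product.1 hp
    by_cases h : NearOnBall r p.1 p.2
    · simpa [h] using hδ
    · simpa [h] using hs _ hV _ hW h
  calc μ.real (transverseOverlap ρ r s)
      ≤ ∑ p ∈ s ×ˢ s, μ.real
          (⋃ _ : ¬ NearOnBall r p.1 p.2, ballPlate ρ p.1 ∩ ballPlate ρ p.2) :=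
        measureReal_biUnion_finset_le _ _
    _ ≤ (s ×ˢ s).card • δ := Finset.sum_le_card_nsmul _ _ _ hpair
    _ = (s.card : ℝ) ^ 2 * δ := by rw [nsmul_eq_mul, Finset.card_product, Nat.cast_mul, sq]

variable [OpensMeasurableSpace E]

theorem measurableSet_transverseOverlap : MeasurableSet (transverseOverlap ρ r s) :=
  (s ×ˢ s).measurableSet_biUnion fun p _ => MeasurableSet.iUnion fun _ =>
    (measurableSet_ballPlate ρ p.1).inter (measurableSet_ballPlate ρ p.2)

theorem measurableSet_lightPairs : MeasurableSet (lightPairs ν c σ ρ s) :=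
  s.measurableSet_biUnion fun V _ => MeasurableSet.iUnion fun _ =>
    (measurableSet_ballPlate ρ V).prod (measurableSet_ballPlate ρ V)

theorem measure_prod_lightPairs_le {μ : Measure E} (hρ : ρ ≤ 1) (hσ : ρ + r ≤ σ) :
    (μ.prod ν) (lightPairs ν c σ ρ s) ≤
      ν Set.univ * μ (transverseOverlap ρ r s) + c * μ Set.univ :=
  measure_prod_le_of_forall_slice_le measurableSet_lightPairs measurableSet_transverseOverlap
    fun _ => measure_slice_lightPairs_le hρ hσ

theorem measure_prod_lightPairs_le_ofReal {μ : Measure E} [IsFiniteMeasure μ] [IsFiniteMeasure ν]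
    {C t ε : ℝ} (hC : 0 ≤ C) (ht : 0 ≤ t) (hμC : μ.real Set.univ ≤ C) (hνC : ν.real Set.univ ≤ C)
    (hε : μ.real (transverseOverlap ρ r s) ≤ ε) (hρ : ρ ≤ 1) (hσ : ρ + r ≤ σ) :
    (μ.prod ν) (lightPairs ν (ENNReal.ofReal t) σ ρ s) ≤ ENNReal.ofReal (C * ε + t * C) := by
  have hε0 : 0 ≤ ε := measureReal_nonneg.trans hε
  calc (μ.prod ν) (lightPairs ν (ENNReal.ofReal t) σ ρ s)
      ≤ ν Set.univ * μ (transverseOverlap ρ r s) + ENNReal.ofReal t * μ Set.univ :=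
        measure_prod_lightPairs_le hρ hσ
    _ ≤ ENNReal.ofReal C * ENNReal.ofReal ε + ENNReal.ofReal t * ENNReal.ofReal C := by
        rw [← ofReal_measureReal (measure_ne_top ν _), ← ofReal_measureReal (measure_ne_top μ _),
          ← ofReal_measureReal (measure_ne_top μ Set.univ)]
        gcongr
    _ = ENNReal.ofReal (C * ε + t * C) := by
        rw [← ENNReal.ofReal_mul hC, ← ENNReal.ofReal_mul ht,
          ENNReal.ofReal_add (by positivity) (by positivity)]

end LightPairs

section Plates

variable {d j k : ℕ} {κ C C' : ℝ} {μ ν : Measure (EuclideanSpace ℝ (Fin d))}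
  {X Y : Set (EuclideanSpace ℝ (Fin d))}

/-- `V` is a `k`-dimensional affine plane: the core of an `(r, k)`-plate. Nonemptiness is required
separately because the empty affine subspace has direction `⊥`. -/
def IsAffinePlane (k : ℕ) (V : AffineSubspace ℝ (EuclideanSpace ℝ (Fin d))) : Prop :=
  (V : Set (EuclideanSpace ℝ (Fin d))).Nonempty ∧ Module.finrank ℝ V.direction = k

theorem IsAffinePlane.isPlate {V : AffineSubspace ℝ (EuclideanSpace ℝ (Fin d))}
    (hV : IsAffinePlane k V) (r : ℝ) :
    IsPlate r k (Metric.thickening r (V : Set (EuclideanSpace ℝ (Fin d)))) :=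
  ⟨V, hV.1, hV.2, rfl⟩

theorem exists_isAffinePlane_zero_mem (hj : j ≤ d) :
    ∃ V : AffineSubspace ℝ (EuclideanSpace ℝ (Fin d)), IsAffinePlane j V ∧ 0 ∈ V := by
  obtain ⟨b, hb⟩ := exists_linearIndependent_of_le_finrank (R := ℝ)
    (M := EuclideanSpace ℝ (Fin d)) (hj.trans_eq finrank_euclideanSpace_fin.symm)
  have hzero := AffineSubspace.self_mem_mk' (0 : EuclideanSpace ℝ (Fin d))
    (Submodule.span ℝ (Set.range b))
  refine ⟨_, ⟨⟨0, hzero⟩, ?_⟩, hzero⟩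
  rw [AffineSubspace.direction_mk', finrank_span_eq_card hb, Fintype.card_fin]

theorem HasPlateDecay.mono (h : HasPlateDecay μ j κ C) (hC : C ≤ C') : HasPlateDecay μ j κ C' :=
  fun r hr H hH => (h r hr H hH).trans (ENNReal.ofReal_le_ofReal (by gcongr))

theorem HasPlateDecay.measureReal_univ_le (h : HasPlateDecay μ j κ C) (hj : j ≤ d) (hC : 0 ≤ C)
    (hμ : μ (Metric.closedBall 0 1)ᶜ = 0) : μ.real Set.univ ≤ C * 2 ^ κ := by
  obtain ⟨V, hV, h0⟩ := exists_isAffinePlane_zero_mem hj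
  refine ENNReal.toReal_le_of_le_ofReal (by positivity) ?_
  calc μ Set.univ = μ (Metric.closedBall 0 1) := (measure_of_measure_compl_eq_zero hμ).symm
    _ ≤ μ (Metric.thickening 2 V) := measure_mono fun x hx => Metric.mem_thickening_iff.2
        ⟨0, h0, (Metric.mem_closedBall.1 hx).trans_lt one_lt_two⟩
    _ ≤ ENNReal.ofReal (C * 2 ^ κ) := h 2 two_pos _ (hV.isPlate 2)

theorem HasPlateDecay.measureReal_ballPlate_inter_le (hμ : HasPlateDecay μ (k - 1) κ C)
    (hC : 0 ≤ C) {r ρ : ℝ} (hρ : 0 < ρ) (hr : r ≤ 1) (hρr : 4 * ρ ≤ r)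
    {V W : AffineSubspace ℝ (EuclideanSpace ℝ (Fin d))} (hV : IsAffinePlane k V)
    (hVW : ¬ NearOnBall r V W) :
    μ.real (ballPlate ρ V ∩ ballPlate ρ W) ≤ C * (18 * ρ / r) ^ κ := by
  have hr0 : 0 < r := by linarith
  rcases (ballPlate ρ V ∩ ballPlate ρ W).eq_empty_or_nonempty with hempty | hne
  · rw [hempty, measureReal_empty]
    positivity
  · obtain ⟨U, hUne, hUdim, hU⟩ := exists_ballPlate_inter_subset_thickening hr hρr hVW hne
    have hUplane : IsAffinePlane (k - 1) U := ⟨hUne, by rw [← hV.2, ← hUdim, Nat.add_sub_cancel]⟩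
    exact ENNReal.toReal_le_of_le_ofReal (by positivity)
      ((measure_mono hU).trans (hμ _ (by positivity) _ (hUplane.isPlate _)))

theorem HasPlateDecay.exists_finset_nearOnBall [IsFiniteMeasure ν]
    (hν : HasPlateDecay ν (k - 1) κ C) (hC : 0 ≤ C) (hνball : ν (Metric.closedBall 0 1)ᶜ = 0)
    {r ρ τ : ℝ} (hρ : 0 < ρ) (hr : r ≤ 1) (hρr : 4 * ρ ≤ r) {L : ℕ}
    (hL : ν.real Set.univ + (L : ℝ) ^ 2 * (C * (18 * ρ / r) ^ κ) < L * τ) :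
    ∃ s : Finset (AffineSubspace ℝ (EuclideanSpace ℝ (Fin d))),
      (∀ W ∈ s, IsAffinePlane k W) ∧ s.card < L ∧
      ∀ V, IsAffinePlane k V → IsConcentrated ν τ (Metric.thickening ρ (V : Set _)) →
        ∃ W ∈ s, NearOnBall r V W := by
  have hr0 : 0 < r := by linarith
  obtain ⟨s, hsS, hsL, hs⟩ := exists_finset_forall_lt_measureReal_inter (by positivity) hL
    (S := {V | IsAffinePlane k V ∧ IsConcentrated ν τ (Metric.thickening ρ (V : Set _))})
    (fun V _ => measurableSet_ballPlate ρ V) fun V hV => by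
      rw [ballPlate, measureReal_def, measure_inter_conull hνball]
      exact (ENNReal.ofReal_le_iff_le_toReal (measure_ne_top _ _)).1 hV.2
  refine ⟨s, fun W hW => (hsS hW).1, hsL, fun V hV hVτ => ?_⟩
  obtain ⟨W, hW, hVW⟩ := hs V ⟨hV, hVτ⟩
  exact ⟨W, hW, by_contra fun hfar =>
    hVW.not_ge (hν.measureReal_ballPlate_inter_le hC hρ hr hρr hV hfar)⟩

theorem concentratedPairs_subset_lightPairs_union (hX : X ⊆ Metric.closedBall 0 1)
    (hY : Y ⊆ Metric.closedBall 0 1) {c t ρ r ρ' σ : ℝ} (hρ : ρ ≤ 1) (hρ' : ρ + r ≤ ρ')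
    (hσ : ρ' ≤ σ) {s : Finset (AffineSubspace ℝ (EuclideanSpace ℝ (Fin d)))}
    (hs : ∀ W ∈ s, IsAffinePlane k W)
    (hnet : ∀ V, IsAffinePlane k V → IsConcentrated ν c (Metric.thickening ρ (V : Set _)) →
      ∃ W ∈ s, NearOnBall r V W) :
    concentratedPairs ν X Y c ρ k ⊆
      lightPairs ν (ENNReal.ofReal t) σ ρ' s ∪ concentratedPairs ν X Y t σ k := by
  rintro ⟨x, y⟩ ⟨hx, hy, _, ⟨V, hVne, hVdim, rfl⟩, hVc, hxV, hyV⟩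
  obtain ⟨W, hW, hVW⟩ := hnet V ⟨hVne, hVdim⟩ hVc
  have hsub : ballPlate ρ V ⊆ ballPlate ρ' W :=
    (hVW.ballPlate_subset hρ).trans (ballPlate_mono hρ' W)
  have hxW := hsub ⟨hxV, hX hx⟩
  have hyW := hsub ⟨hyV, hY hy⟩
  by_cases hlight : ν (Metric.thickening σ (W : Set _)) < ENNReal.ofReal t
  · exact Or.inl (mem_lightPairs.2 ⟨W, hW, hlight, hxW, hyW⟩)
  · exact Or.inr ⟨hx, hy, _, (hs W hW).isPlate σ, not_lt.1 hlight,
      (ballPlate_mono hσ W hxW).1, (ballPlate_mono hσ W hyW).1⟩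

theorem exists_nat_add_sq_mul_lt {C t δ : ℝ} (hC : 1 ≤ C) (ht : 0 < t) (ht1 : t ≤ 1) (hδ : 0 ≤ δ)
    (h : 9 * C ^ 3 * δ ≤ t ^ 5) :
    ∃ L : ℕ, C + (L : ℝ) ^ 2 * δ < L * t ^ 2 ∧ C * ((L : ℝ) ^ 2 * δ) ≤ t := by
  set L := ⌊2 * C / t ^ 2⌋₊ + 1 with hL
  have hlower : 2 * C < L * t ^ 2 := by
    rw [← div_lt_iff₀ (by positivity), hL]
    exact_mod_cast Nat.lt_floor_add_one _
  have hupper : L * t ^ 2 ≤ 3 * C := by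
    have hfloor := Nat.floor_le (a := 2 * C / t ^ 2) (by positivity)
    rw [le_div_iff₀ (by positivity)] at hfloor
    rw [hL]
    push_cast
    linarith [pow_le_one₀ (n := 2) ht.le ht1]
  have hsmall : C * ((L : ℝ) ^ 2 * δ) ≤ t := by
    refine le_of_mul_le_mul_right (a := t ^ 4) ?_ (by positivity)
    calc C * ((L : ℝ) ^ 2 * δ) * t ^ 4 = (L * t ^ 2) ^ 2 * (C * δ) := by ring
      _ ≤ (3 * C) ^ 2 * (C * δ) := by gcongr
      _ = 9 * C ^ 3 * δ := by ring
      _ ≤ t ^ 5 := h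
      _ = t * t ^ 4 := by ring
  have hone : (L : ℝ) ^ 2 * δ ≤ C * ((L : ℝ) ^ 2 * δ) := le_mul_of_one_le_left (by positivity) hC
  exact ⟨L, by linarith, hsmall⟩

-- Planes are told apart at scale `σ * q` in the net and at scale `σ / 2` in the overlap; either way
-- the neighbourhoods intersected are thinner by a factor of order `q`.
theorem HasPlateDecay.exists_concentratedPairs_subset [IsFiniteMeasure μ] [IsFiniteMeasure ν]
    (hμ : HasPlateDecay μ (k - 1) κ C) (hν : HasPlateDecay ν (k - 1) κ C) (hκ : 0 < κ)
    (hC : 1 ≤ C) (hμC : μ.real Set.univ ≤ C) (hνC : ν.real Set.univ ≤ C)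
    (hX : X ⊆ Metric.closedBall 0 1) (hY : Y ⊆ Metric.closedBall 0 1) (hνY : ν Yᶜ = 0)
    {t σ q : ℝ} (ht : 0 < t) (ht1 : t ≤ 1) (hσ : 0 < σ) (hσ1 : σ ≤ 1) (hq : 0 < q)
    (hsmall : 9 * C ^ 3 * (C * (72 * q) ^ κ) ≤ t ^ 5) :
    ∃ D, MeasurableSet D ∧ (μ.prod ν) D ≤ ENNReal.ofReal ((1 + C) * t) ∧
      concentratedPairs ν X Y (t ^ 2) (σ * q ^ 2) k ⊆ D ∪ concentratedPairs ν X Y t σ k := by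
  set δ := C * (72 * q) ^ κ
  have hC0 : 0 ≤ C := by linarith
  have hδ : 0 ≤ δ := by positivity
  have hq72 : 72 * q ≤ 1 := by
    by_contra! hlt
    have hpow := Real.one_lt_rpow hlt hκ
    have hlarge : 1 ≤ C ^ 3 * δ := one_le_mul_of_one_le_of_one_le (one_le_pow₀ hC)
      (one_le_mul_of_one_le_of_one_le hC hpow.le)
    linarith [pow_le_one₀ (n := 5) ht.le ht1]
  have hσq : 0 < σ * q := by positivity
  have hσq1 : 72 * (σ * q) ≤ σ := by nlinarith
  have hσq2 : 72 * (σ * q ^ 2) ≤ σ * q := by nlinarith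
  obtain ⟨L, hL, hLt⟩ := exists_nat_add_sq_mul_lt hC ht ht1 hδ hsmall
  have hmass : ν.real Set.univ + (L : ℝ) ^ 2 * (C * (18 * (σ * q ^ 2) / (σ * q)) ^ κ) <
      L * t ^ 2 := by
    rw [show 18 * (σ * q ^ 2) / (σ * q) = 18 * q by field_simp]
    refine lt_of_le_of_lt (add_le_add hνC ?_) hL
    dsimp only [δ]
    gcongr
    norm_num
  obtain ⟨s, hs, hsL, hnet⟩ := hν.exists_finset_nearOnBall hC0
    (measure_mono_null (Set.compl_subset_compl.2 hY) hνY) (by positivity) (by linarith)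
    (by linarith) hmass
  have hoverlap : μ.real (transverseOverlap (2 * (σ * q)) (σ / 2) s) ≤ (L : ℝ) ^ 2 * δ := by
    refine (measureReal_transverseOverlap_le hδ fun V hV W _ hVW => ?_).trans (by gcongr)
    refine (hμ.measureReal_ballPlate_inter_le hC0 (by positivity) (by linarith) (by linarith)
      (hs V hV) hVW).trans_eq ?_
    rw [show 18 * (2 * (σ * q)) / (σ / 2) = 72 * q by field_simp; norm_num]
  have hlight := measure_prod_lightPairs_le_ofReal hC0 ht.le hμC hνC hoverlap (σ := σ)
    (by linarith) (by linarith)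
  exact ⟨_, measurableSet_lightPairs,
    hlight.trans (ENNReal.ofReal_le_ofReal (by linarith)), concentratedPairs_subset_lightPairs_union
      hX hY (by linarith) (by linarith) (by linarith) hs hnet⟩

theorem nine_mul_le_nine_mul_pow_mul_rpow (hκ : 0 ≤ κ) (hC : 1 ≤ C) :
    9 * C ≤ 9 * C ^ 4 * 72 ^ κ := by
  calc 9 * C ≤ 9 * C ^ 4 := by
        gcongr
        exact le_self_pow₀ hC four_ne_zero
    _ ≤ 9 * C ^ 4 * 72 ^ κ :=
        le_mul_of_one_le_right (by positivity) (Real.one_le_rpow (by norm_num) hκ)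

theorem exists_concentratedPairs_relScale_subset [IsFiniteMeasure μ] [IsFiniteMeasure ν]
    (hμ : HasPlateDecay μ (k - 1) κ C) (hν : HasPlateDecay ν (k - 1) κ C) (hκ : 0 < κ)
    (hC : 1 ≤ C) (hμC : μ.real Set.univ ≤ C) (hνC : ν.real Set.univ ≤ C)
    (hX : X ⊆ Metric.closedBall 0 1) (hY : Y ⊆ Metric.closedBall 0 1) (hνY : ν Yᶜ = 0)
    {K r₀ : ℝ} (hK : 9 * C ^ 4 * 72 ^ κ ≤ K) (hr₀ : 0 < r₀) (hr₀1 : r₀ ≤ 1) (n : ℕ) :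
    ∃ D, MeasurableSet D ∧
      (μ.prod ν) D ≤ ENNReal.ofReal ((1 + C) * concThreshold K n) ∧
      concentratedPairs ν X Y (concThreshold K (n + 1)) (relScale κ K (n + 1) * r₀) k ⊆
        D ∪ concentratedPairs ν X Y (concThreshold K n) (relScale κ K n * r₀) k := by
  have hK2 : 2 ≤ K := by linarith [nine_mul_le_nine_mul_pow_mul_rpow hκ.le hC]
  have hK0 : 0 < K := by linarith
  have ht := concThreshold_pos hK0 n
  have hKt := mul_concThreshold_le_one hK2 n
  have hσ : 0 < relScale κ K n := relScale_pos hK0 n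
  have hσ1 : relScale κ K n ≤ 1 := relScale_le_one hκ hK2 n
  rw [relScale_succ hK0, concThreshold_succ, mul_right_comm]
  refine hμ.exists_concentratedPairs_subset hν hκ hC hμC hνC hX hY hνY ht (by nlinarith)
    (by positivity) (mul_le_one₀ hσ1 hr₀.le hr₀1) (by positivity) ?_
  calc 9 * C ^ 3 * (C * (72 * concThreshold K n ^ (6 / κ)) ^ κ)
      = 9 * C ^ 4 * 72 ^ κ * concThreshold K n ^ 6 := by
        rw [Real.mul_rpow (by norm_num) (by positivity), ← Real.rpow_mul ht.le,
          div_mul_cancel₀ _ hκ.ne', Real.rpow_ofNat]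
        ring
    _ ≤ K * concThreshold K n ^ 6 := by gcongr
    _ = K * concThreshold K n * concThreshold K n ^ 5 := by ring
    _ ≤ concThreshold K n ^ 5 := mul_le_of_le_one_left (by positivity) hKt

theorem measure_iUnion_le_of_le_concThreshold {Ω : Type*} [MeasurableSpace Ω] {m : Measure Ω}
    {D : ℕ → Set Ω} {K : ℝ} (hK : 2 ≤ K) (hC : 0 ≤ C)
    (hD : ∀ n, m (D n) ≤ ENNReal.ofReal (C * concThreshold K n)) :
    m (⋃ n, D n) ≤ ENNReal.ofReal (2 * C * K⁻¹) := by
  have hCK : 0 ≤ C * K⁻¹ := mul_nonneg hC (inv_nonneg.2 (by linarith))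
  have hsum : HasSum (fun n : ℕ => C * K⁻¹ * (1 / 2) ^ n) (C * K⁻¹ * 2) :=
    hasSum_geometric_two.mul_left _
  calc m (⋃ n, D n) ≤ ∑' n, m (D n) := measure_iUnion_le D
    _ ≤ ∑' n : ℕ, ENNReal.ofReal (C * K⁻¹ * (1 / 2) ^ n) := by
        refine ENNReal.tsum_le_tsum fun n => (hD n).trans (ENNReal.ofReal_le_ofReal ?_)
        rw [mul_assoc]
        gcongr
        exact concThreshold_le_inv_mul hK n
    _ = ENNReal.ofReal (2 * C * K⁻¹) := by
        rw [← ENNReal.ofReal_tsum_of_nonneg (fun n => mul_nonneg hCK (by positivity)) hsum.summable,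
          hsum.tsum_eq]
        ring_nf

theorem exists_measurableSet_forall_concentratedPairs_subset [IsFiniteMeasure μ]
    [IsFiniteMeasure ν] (hμ : HasPlateDecay μ (k - 1) κ C) (hν : HasPlateDecay ν (k - 1) κ C)
    (hκ : 0 < κ) (hC : 1 ≤ C) (hμC : μ.real Set.univ ≤ C) (hνC : ν.real Set.univ ≤ C)
    (hX : X ⊆ Metric.closedBall 0 1) (hY : Y ⊆ Metric.closedBall 0 1) (hνY : ν Yᶜ = 0)
    {K r₀ : ℝ} (hK : 9 * C ^ 4 * 72 ^ κ ≤ K) (hr₀ : 0 < r₀) (hr₀1 : r₀ ≤ 1) :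
    ∃ D, MeasurableSet D ∧ (μ.prod ν) D ≤ ENNReal.ofReal (2 * (1 + C) * K⁻¹) ∧
      ∀ n, concentratedPairs ν X Y (concThreshold K n) (relScale κ K n * r₀) k ⊆
        concentratedPairs ν X Y K⁻¹ r₀ k ∪ D := by
  have hK2 : 2 ≤ K := by linarith [nine_mul_le_nine_mul_pow_mul_rpow hκ.le hC]
  choose D hDmeas hDle hDsub using exists_concentratedPairs_relScale_subset hμ hν hκ hC hμC hνC
    hX hY hνY hK hr₀ hr₀1
  refine ⟨⋃ n, D n, MeasurableSet.iUnion hDmeas,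
    measure_iUnion_le_of_le_concThreshold hK2 (by linarith) hDle, fun n => ?_⟩
  induction n with
  | zero =>
    rw [concThreshold_zero, relScale_zero (by linarith), one_mul]
    exact Set.subset_union_left
  | succ n ih =>
    exact (hDsub n).trans (Set.union_subset
      ((Set.subset_iUnion D n).trans Set.subset_union_right) ih)

theorem measure_plate_inter_notMem_concentratedPairs_le {c r s : ℝ} (hrs : r ≤ s)
    {H : Set (EuclideanSpace ℝ (Fin d))} (hH : IsPlate r k H)
    {x : EuclideanSpace ℝ (Fin d)} (hxH : x ∈ H) (hxX : x ∈ X) (hνY : ν Yᶜ = 0) :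
    ν (H ∩ {y | (x, y) ∉ concentratedPairs ν X Y c s k}) ≤ ENNReal.ofReal c := by
  obtain ⟨V, hVne, hVdim, rfl⟩ := hH
  have hsub := Metric.thickening_mono hrs (V : Set (EuclideanSpace ℝ (Fin d)))
  by_cases hc : IsConcentrated ν c (Metric.thickening s (V : Set (EuclideanSpace ℝ (Fin d))))
  · have hnull : ν (Metric.thickening r V ∩ {y | (x, y) ∉ concentratedPairs ν X Y c s k}) = 0 :=
      measure_mono_null (fun y hy hyY => hy.2
        ⟨hxX, hyY, _, ⟨V, hVne, hVdim, rfl⟩, hc, hsub hxH, hsub hy.1⟩) hνY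
    exact hnull.trans_le zero_le
  · exact (measure_mono (Set.inter_subset_left.trans hsub)).trans (not_le.1 hc).le

theorem hasThinPlates_compl_of_forall_concentratedPairs_subset {K r₀ : ℝ} (hκ : 0 < κ)
    (hK : 2 ≤ K) (hνK : ν Set.univ ≤ ENNReal.ofReal K) (hνY : ν Yᶜ = 0) (hr₀ : 0 < r₀)
    {G : Set (EuclideanSpace ℝ (Fin d) × EuclideanSpace ℝ (Fin d))} (hXG : Xᶜ ×ˢ Set.univ ⊆ G)
    (hG : ∀ n, concentratedPairs ν X Y (concThreshold K n) (relScale κ K n * r₀) k ⊆ G) (r₁ : ℝ) :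
    HasThinPlates ν k (κ / 24) (K * r₀ ^ (-(κ / 24))) Gᶜ r₁ := by
  intro x r hr _ H hH hxH
  have hscale : K * r₀ ^ (-(κ / 24)) * r ^ (κ / 24) = K * (r / r₀) ^ (κ / 24) := by
    rw [Real.rpow_neg hr₀.le, Real.div_rpow hr.le hr₀.le]
    ring
  rw [hscale]
  by_cases hxX : x ∉ X
  · have hempty : H ∩ {y | (x, y) ∈ Gᶜ} = ∅ :=
      Set.eq_empty_of_forall_notMem fun y hy => hy.2 (hXG ⟨hxX, trivial⟩)
    exact (measure_mono_null hempty.subset measure_empty).trans_le zero_le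
  rw [not_not] at hxX
  rcases le_total r₀ r with hr₀r | hrr₀
  · refine (measure_mono (Set.subset_univ _)).trans (hνK.trans (ENNReal.ofReal_le_ofReal ?_))
    exact le_mul_of_one_le_right (by linarith)
      (Real.one_le_rpow ((one_le_div hr₀).2 hr₀r) (by positivity))
  · obtain ⟨n, hn, hnu⟩ := exists_le_relScale_concThreshold_le hκ hK (div_pos hr hr₀)
      ((div_le_one hr₀).2 hrr₀)
    calc ν (H ∩ {y | (x, y) ∈ Gᶜ})
        ≤ ν (H ∩ {y | (x, y) ∉ concentratedPairs ν X Y (concThreshold K n)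
            (relScale κ K n * r₀) k}) :=
          measure_mono (Set.inter_subset_inter_right _ fun y hy h => hy (hG n h))
      _ ≤ ENNReal.ofReal (concThreshold K n) :=
          measure_plate_inter_notMem_concentratedPairs_le ((div_le_iff₀ hr₀).1 hn) hH hxH hxX hνY
      _ ≤ ENNReal.ofReal (K * (r / r₀) ^ (κ / 24)) :=
          ENNReal.ofReal_le_ofReal
            (hnu.trans (le_mul_of_one_le_left (by positivity) (by linarith)))

theorem exists_measurableSet_hasThinPlates [IsFiniteMeasure μ] [IsFiniteMeasure ν]
    (hμ : HasPlateDecay μ (k - 1) κ C) (hν : HasPlateDecay ν (k - 1) κ C) (hκ : 0 < κ)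
    (hC : 1 ≤ C) (hμC : μ.real Set.univ ≤ C) (hνC : ν.real Set.univ ≤ C)
    (hX : X ⊆ Metric.closedBall 0 1) (hY : Y ⊆ Metric.closedBall 0 1) (hμX : μ Xᶜ = 0)
    (hνY : ν Yᶜ = 0) {K r₀ : ℝ} (hK : 9 * C ^ 4 * 72 ^ κ ≤ K) (hr₀ : 0 < r₀) (hr₀1 : r₀ ≤ 1) :
    ∃ B, MeasurableSet B ∧ (μ.prod ν) B ≤ ENNReal.ofReal (9 * C ^ 4 * 72 ^ κ * K⁻¹) ∧
      ∀ r₁, HasThinPlates ν k (κ / 24) (K * r₀ ^ (-(κ / 24)))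
        (concentratedPairs ν X Y K⁻¹ r₀ k ∪ B)ᶜ r₁ := by
  have hconst := nine_mul_le_nine_mul_pow_mul_rpow hκ.le hC
  obtain ⟨D, hDmeas, hDle, hD⟩ := exists_measurableSet_forall_concentratedPairs_subset
    hμ hν hκ hC hμC hνC hX hY hνY hK hr₀ hr₀1
  set N := toMeasurable μ Xᶜ ×ˢ (Set.univ : Set (EuclideanSpace ℝ (Fin d)))
  have hN : (μ.prod ν) N = 0 := by
    rw [Measure.prod_prod, measure_toMeasurable, hμX, zero_mul]
  have hXN : Xᶜ ×ˢ Set.univ ⊆ N := Set.prod_mono (subset_toMeasurable _ _) subset_rfl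
  refine ⟨N ∪ D, ((measurableSet_toMeasurable _ _).prod .univ).union hDmeas, ?_, fun r₁ => ?_⟩
  · calc (μ.prod ν) (N ∪ D) ≤ (μ.prod ν) N + (μ.prod ν) D := measure_union_le _ _
      _ ≤ ENNReal.ofReal (2 * (1 + C) * K⁻¹) := by rwa [hN, zero_add]
      _ ≤ ENNReal.ofReal (9 * C ^ 4 * 72 ^ κ * K⁻¹) := by
        have hK0 : 0 ≤ K⁻¹ := inv_nonneg.2 (by linarith)
        exact ENNReal.ofReal_le_ofReal (mul_le_mul_of_nonneg_right (by linarith) hK0)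
  · rw [Set.union_left_comm]
    refine hasThinPlates_compl_of_forall_concentratedPairs_subset hκ (by linarith) ?_ hνY hr₀
      (hXN.trans Set.subset_union_left) (fun n => (hD n).trans Set.subset_union_right) r₁
    rw [← ofReal_measureReal (measure_ne_top ν _)]
    exact ENNReal.ofReal_le_ofReal (by linarith)

end Plates

theorem mainTheorem11 (d k : ℕ) (hk : 1 ≤ k) (hkd : k < d) (κ : ℝ) (hκ : 0 < κ) :
    ∃ η : ℝ, 0 < η ∧ ∀ Cμ Cν : ℝ, ∃ K₀ : ℝ, 0 < K₀ ∧
      ∀ r₀ : ℝ, 0 < r₀ → r₀ ≤ 1 → ∀ K : ℝ, K₀ ≤ K →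
      ∀ (μ ν : Measure (EuclideanSpace ℝ (Fin d))) [IsFiniteMeasure μ] [IsFiniteMeasure ν]
        (X Y : Set (EuclideanSpace ℝ (Fin d))),
        X ⊆ Metric.closedBall 0 1 → Y ⊆ Metric.closedBall 0 1 →
        μ Xᶜ = 0 → ν Yᶜ = 0 →
        HasPlateDecay μ (k - 1) κ Cμ → HasPlateDecay ν (k - 1) κ Cν →
        ∃ B : Set (EuclideanSpace ℝ (Fin d) × EuclideanSpace ℝ (Fin d)),
          MeasurableSet B ∧
          (μ.prod ν) B ≤ ENNReal.ofReal (K₀ * K⁻¹) ∧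
          ∀ r₁ : ℝ, HasThinPlates ν k η (K * r₀ ^ (-η))
            (concentratedPairs ν X Y K⁻¹ r₀ k ∪ B)ᶜ r₁ := by
  refine ⟨κ / 24, by positivity, fun Cμ Cν => ?_⟩
  set M := max 1 (max Cμ Cν)
  have hM : 1 ≤ M := le_max_left _ _
  have hMC : M ≤ M * 2 ^ κ :=
    le_mul_of_one_le_right (by linarith) (Real.one_le_rpow one_le_two hκ.le)
  refine ⟨9 * (M * 2 ^ κ) ^ 4 * 72 ^ κ, by positivity,
    fun r₀ hr₀ hr₀1 K hK μ ν _ _ X Y hX hY hμX hνY hμ hν => ?_⟩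
  replace hμ : HasPlateDecay μ (k - 1) κ M :=
    hμ.mono ((le_max_left _ _).trans (le_max_right _ _))
  replace hν : HasPlateDecay ν (k - 1) κ M :=
    hν.mono ((le_max_right _ _).trans (le_max_right _ _))
  have hμM := hμ.measureReal_univ_le (by omega) (by linarith)
    (measure_mono_null (Set.compl_subset_compl.2 hX) hμX)
  have hνM := hν.measureReal_univ_le (by omega) (by linarith)
    (measure_mono_null (Set.compl_subset_compl.2 hY) hνY)
  exact exists_measurableSet_hasThinPlates (hμ.mono hMC) (hν.mono hMC) hκ (hM.trans hMC) hμM hνM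
    hX hY hμX hνY hK hr₀ hr₀1
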